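/- Let $\sigma$ be a two-qubit state, i.e. a positive semidefinite operator of trace one on $\mathbb{C}^2\otimes\mathbb{C}^2$, with eigenvalues $a_1\ge a_2\ge a_3\ge a_4$ (counted with multiplicity). For a two-qubit state $\rho$ let $T_\rho=[t_{ij}]_{i,j=1}^3$, $t_{ij}=\mathrm{Tr}[\rho\,(s_i\otimes s_j)]$, be its correlation matrix ($s_1,s_2,s_3$ the Pauli matrices), and let $M(\rho)$ be the sum of the two largest eigenvalues (counted with multiplicity) of $T_\rho^{\mathsf T}T_\rho$. Call $\rho$ Bell-CHSH local if $M(\rho)\le 1$, and call $\sigma$ absolutely Bell-CHSH local if $U\sigma U^\dagger$ is Bell-CHSH local for every unitary $U$ on $\mathbb{C}^2\otimes\mathbb{C}^2$. Then $\sigma$ is absolutely Bell-CHSH local if and only if $$(2a_1+2a_2-1)^2+(2a_1+2a_3-1)^2\le 1 .$$ Moreover, $$\max_{U}\,M(U\sigma U^\dagger)=(2a_1+2a_2-1)^2+(2a_1+2a_3-1)^2 ,$$ where $U$ ranges over all unitaries on $\mathbb{C}^2\otimes\mathbb{C}^2$, and the maximum is attained at every Bell-diagonal state with the same spectrum as $\sigma$: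 for every permutation $\pi$ of $\{1,2,3,4\}$ the state $\sum_{k=1}^4 a_{\pi(k)}|\phi_k\rangle\langle\phi_k|$, where $\phi_1,\dots,\phi_4$ are the Bell states $(|00\rangle\pm|11\rangle)/\sqrt2$, $(|01\rangle\pm|10\rangle)/\sqrt2$, is of the form $U\sigma U^\dagger$ with $U$ unitary, and its value of $M$ is this maximum. -/

import Mathlib

open scoped Matrix Kronecker ComplexOrder

noncomputable section

/-- Operators on `ℂ² ⊗ ℂ²`, as matrices in the computational basis `|i j⟩`, `i, j ∈ {0, 1}`. -/
abbrev TwoQubitOp := Matrix (Fin 2 × Fin 2) (Fin 2 × Fin 2) ℂ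

/-- A two-qubit state: a positive semidefinite operator of trace one. -/
def IsTwoQubitState (σ : TwoQubitOp) : Prop :=
  σ.PosSemidef ∧ σ.trace = 1

/-- The three Pauli matrices. -/
def pauli : Fin 3 → Matrix (Fin 2) (Fin 2) ℂ :=
  ![!![0, 1; 1, 0], !![0, -Complex.I; Complex.I, 0], !![1, 0; 0, -1]]

/-- The correlation matrix `t i j = Tr (σ (s i ⊗ s j))`.  For Hermitian `σ` these traces are
real, so taking the real part only changes the type. -/
def correlationMatrix (σ : TwoQubitOp) : Matrix (Fin 3) (Fin 3) ℝ :=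
  Matrix.of fun i j => (Matrix.trace (σ * (pauli i ⊗ₖ pauli j))).re

theorem correlationGram_isHermitian (σ : TwoQubitOp) :
    ((correlationMatrix σ)ᵀ * correlationMatrix σ).IsHermitian := by
  rw [← Matrix.conjTranspose_eq_transpose_of_trivial]
  exact Matrix.isHermitian_conjTranspose_mul_self _

/-- The eigenvalues of a Hermitian matrix of size `m`, counted with multiplicity, in decreasing
order. -/
def sortedEigenvalues {n : Type*} [Fintype n] [DecidableEq n] {𝕜 : Type*} [RCLike 𝕜]
    {A : Matrix n n 𝕜} (hA : A.IsHermitian) (m : ℕ) (hm : m = Fintype.card n) : Fin m → ℝ :=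
  fun k => hA.eigenvalues₀ (Fin.cast hm k)

/-- The Horodecki quantity: the sum of the two largest eigenvalues of `Tᵀ T`. -/
def horodeckiM (σ : TwoQubitOp) : ℝ :=
  sortedEigenvalues (correlationGram_isHermitian σ) 3 (by simp) 0 +
    sortedEigenvalues (correlationGram_isHermitian σ) 3 (by simp) 1

/-- The state `U σ U†`. -/
def unitaryConj (U : Matrix.unitaryGroup (Fin 2 × Fin 2) ℂ) (σ : TwoQubitOp) : TwoQubitOp :=
  (U : TwoQubitOp) * σ * (U : TwoQubitOp)ᴴ

def IsBellCHSHLocal (σ : TwoQubitOp) : Prop :=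
  horodeckiM σ ≤ 1

def IsAbsolutelyBellCHSHLocal (σ : TwoQubitOp) : Prop :=
  ∀ U : Matrix.unitaryGroup (Fin 2 × Fin 2) ℂ, IsBellCHSHLocal (unitaryConj U σ)

/-- The computational basis vector `|i j⟩`. -/
def ket (i j : Fin 2) : Fin 2 × Fin 2 → ℂ :=
  Pi.single (i, j) 1

/-- The four Bell states `(|00⟩ ± |11⟩)/√2`, `(|01⟩ ± |10⟩)/√2`. -/
def bellState : Fin 4 → Fin 2 × Fin 2 → ℂ :=
  ![((√2 : ℝ) : ℂ)⁻¹ • (ket 0 0 + ket 1 1), ((√2 : ℝ) : ℂ)⁻¹ • (ket 0 0 - ket 1 1),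
    ((√2 : ℝ) : ℂ)⁻¹ • (ket 0 1 + ket 1 0), ((√2 : ℝ) : ℂ)⁻¹ • (ket 0 1 - ket 1 0)]

/-- The Bell-diagonal operator `∑ k, p k |φ k⟩⟨φ k|`. -/
def bellDiagonal (p : Fin 4 → ℝ) : TwoQubitOp :=
  ∑ k, (p k : ℂ) • Matrix.vecMulVec (bellState k) (star (bellState k))

end

/-! Write α ≥ β for the two largest singular values of the correlation matrix T of a state with
spectrum `a`, so that M = α² + β². Each singular value is the expectation of a product spin
observable, a traceless Hermitian involution P. Since (1 + P)/2 is a projection of rank 2, α ≤ K :=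
a₀ + a₁ - a₂ - a₃ (`trace_mul_involution_le`). The observables P, Q of α and β commute, because two
anticommutation signs cancel; comparing the joint eigenprojections (1 ± P)(1 ± Q)/4 of equal sign,
which have rank 1, gives α + β ≤ 2(a₀ - a₃) = K + L with L := a₀ + a₂ - a₁ - a₃
(`trace_mul_commuting_involutions_le`). Under these constraints α² + β² is largest at (K, L)
(`add_sq_le_of_le_of_add_le`), and trace one turns K² + L² into the stated value. The bound depends
only on the spectrum, hence holds on the whole unitary orbit.

Conversely, T is diagonal at a Bell-diagonal state, with entries ±(2(a₀ + aⱼ) - 1) for j = 1, 2, 3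
in some order; dropping j = 3 leaves exactly the bound. -/

theorem exists_sortedEigenvalues_diagonalization {n : Type*} [Fintype n] [DecidableEq n]
    {𝕜 : Type*} [RCLike 𝕜] {A : Matrix n n 𝕜} (hA : A.IsHermitian) (m : ℕ)
    (hm : m = Fintype.card n) :
    ∃ W : Matrix n (Fin m) 𝕜, Wᴴ * W = 1 ∧ W * Wᴴ = 1 ∧
      A = W * Matrix.diagonal (fun k => (sortedEigenvalues hA m hm k : 𝕜)) * Wᴴ := by
  let e : Fin m ≃ n := (finCongr hm).trans (Fintype.equivOfCardEq (Fintype.card_fin _))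
  have he : ∀ k, sortedEigenvalues hA m hm k = hA.eigenvalues (e k) := by
    intro k
    simp [sortedEigenvalues, Matrix.IsHermitian.eigenvalues, e]
  let V : Matrix n n 𝕜 := hA.eigenvectorUnitary
  have hV1 : Vᴴ * V = 1 := Unitary.coe_star_mul_self hA.eigenvectorUnitary
  have hV2 : V * Vᴴ = 1 := Unitary.coe_mul_star_self hA.eigenvectorUnitary
  have hd : Matrix.diagonal (fun k => (sortedEigenvalues hA m hm k : 𝕜)) =
      (Matrix.diagonal (RCLike.ofReal ∘ hA.eigenvalues) : Matrix n n 𝕜).submatrix e e := by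
    rw [Matrix.submatrix_diagonal_equiv]
    congr 1
    funext k
    simp [he]
  refine ⟨V.submatrix id e, ?_, ?_, ?_⟩
  · rw [Matrix.conjTranspose_submatrix]
    rw [← Matrix.submatrix_mul _ _ e id e Function.bijective_id, hV1, Matrix.submatrix_one_equiv]
  · rw [Matrix.conjTranspose_submatrix, Matrix.submatrix_mul_equiv, hV2]
    simp
  · rw [hd, Matrix.conjTranspose_submatrix, Matrix.submatrix_mul_equiv,
      Matrix.submatrix_mul_equiv, Matrix.submatrix_id_id]
    exact hA.spectral_theorem

theorem sortedEigenvalues_antitone {n : Type*} [Fintype n] [DecidableEq n]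
    {𝕜 : Type*} [RCLike 𝕜] {A : Matrix n n 𝕜} (hA : A.IsHermitian) (m : ℕ)
    (hm : m = Fintype.card n) : Antitone (sortedEigenvalues hA m hm) := by
  intro i j hij
  exact hA.eigenvalues₀_antitone (by simpa using hij)

/-- The trace of a matrix with spectrum `a` against an orthogonal projection is a weighted sum of
the `a j`, with weights in `[0, 1]` adding up to the rank of the projection. -/
theorem exists_weights_trace_mul_projection {n m : Type*} [Fintype n] [DecidableEq n]
    [Fintype m] [DecidableEq m] {W : Matrix n m ℂ} (hW : W * Wᴴ = 1)
    {P : Matrix n n ℂ} (hP : P.IsHermitian) (hPP : P * P = P) (a : m → ℝ) :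
    ∃ q : m → ℝ, (∀ j, 0 ≤ q j) ∧ (∀ j, q j ≤ 1) ∧ ∑ j, q j = P.trace.re ∧
      (W * Matrix.diagonal (fun j => (a j : ℂ)) * Wᴴ * P).trace.re = ∑ j, a j * q j := by
  set R : Matrix m m ℂ := Wᴴ * P * W with hR
  have hRh : Rᴴ = R := by
    simp [hR, Matrix.conjTranspose_mul, hP.eq, Matrix.mul_assoc]
  have hRR : R * R = R := by
    calc R * R = Wᴴ * P * (W * Wᴴ) * P * W := by simp only [hR, Matrix.mul_assoc]
      _ = Wᴴ * (P * P) * W := by simp only [hW, Matrix.mul_one, Matrix.mul_assoc]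
      _ = R := by rw [hPP]
  -- The weights are the diagonal entries of the compressed projection R. From R = R² = Rᴴ, each is
  -- the squared norm of its row, so it is nonnegative and dominates its own square.
  have hdiag : ∀ j, (R j j).re = ∑ k, Complex.normSq (R j k) := by
    intro j
    have h : (R * R) j j = R j j := by rw [hRR]
    rw [← h, Matrix.mul_apply, Complex.re_sum]
    refine Finset.sum_congr rfl fun k _ => ?_
    have hk : R k j = star (R j k) := by
      conv_lhs => rw [← hRh, Matrix.conjTranspose_apply]
    rw [hk, Complex.star_def, Complex.mul_conj, Complex.ofReal_re]
  have h0 : ∀ j, 0 ≤ (R j j).re := fun j => by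
    rw [hdiag]
    exact Finset.sum_nonneg fun k _ => Complex.normSq_nonneg _
  refine ⟨fun j => (R j j).re, h0, fun j => ?_, ?_, ?_⟩
  · have h1 : Complex.normSq (R j j) ≤ (R j j).re := by
      rw [hdiag j]
      exact Finset.single_le_sum (f := fun k => Complex.normSq (R j k))
        (fun k _ => Complex.normSq_nonneg _) (Finset.mem_univ j)
    rw [Complex.normSq_apply] at h1
    nlinarith [h0 j, mul_self_nonneg (R j j).im]
  · have h : R.trace = P.trace := by
      rw [hR, Matrix.mul_assoc, Matrix.trace_mul_comm, Matrix.mul_assoc, hW, Matrix.mul_one]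
    rw [← h, Matrix.trace, Complex.re_sum]
    rfl
  · have h : (W * Matrix.diagonal (fun j => (a j : ℂ)) * Wᴴ * P).trace =
        (Matrix.diagonal (fun j => (a j : ℂ)) * R).trace := by
      rw [Matrix.mul_assoc, Matrix.mul_assoc, Matrix.trace_mul_comm, hR, Matrix.mul_assoc,
        Matrix.mul_assoc]
    rw [h, Matrix.trace, Complex.re_sum]
    refine Finset.sum_congr rfl fun j _ => ?_
    simp [Matrix.diagonal_mul]

/-! ### Spin observables and the correlation form -/

/-- The observable `x · s` of a spin measurement in direction `x`. -/
def pauliVec (x : Fin 3 → ℝ) : Matrix (Fin 2) (Fin 2) ℂ :=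
  ∑ i, (x i : ℂ) • pauli i

theorem pauliVec_eq (x : Fin 3 → ℝ) :
    pauliVec x = !![(x 2 : ℂ), x 0 - x 1 * Complex.I; x 0 + x 1 * Complex.I, -(x 2 : ℂ)] := by
  ext i j
  fin_cases i <;> fin_cases j <;>
    simp [pauliVec, pauli, Fin.sum_univ_three, sub_eq_add_neg]

theorem pauliVec_isHermitian (x : Fin 3 → ℝ) : (pauliVec x).IsHermitian := by
  rw [pauliVec_eq]
  ext i j
  fin_cases i <;> fin_cases j <;> simp [Matrix.conjTranspose_apply, sub_eq_add_neg]

theorem trace_pauliVec (x : Fin 3 → ℝ) : (pauliVec x).trace = 0 := by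
  simp [pauliVec_eq, Matrix.trace_fin_two]

theorem pauliVec_mul_add_mul (x y : Fin 3 → ℝ) :
    pauliVec x * pauliVec y + pauliVec y * pauliVec x = ((2 * (x ⬝ᵥ y) : ℝ) : ℂ) • 1 := by
  rw [pauliVec_eq, pauliVec_eq]
  ext i j
  fin_cases i <;> fin_cases j <;>
    simp [dotProduct, Fin.sum_univ_three] <;>
    ring_nf <;> simp only [Complex.I_sq] <;> ring

theorem pauliVec_mul_self {x : Fin 3 → ℝ} (hx : x ⬝ᵥ x = 1) : pauliVec x * pauliVec x = 1 := by
  have h := pauliVec_mul_add_mul x x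
  rw [hx, ← two_smul ℂ] at h
  have h2 : (((2 * 1 : ℝ) : ℂ)) = 2 := by norm_num
  rw [h2] at h
  exact smul_right_injective _ (two_ne_zero : (2 : ℂ) ≠ 0) h

theorem pauliVec_mul_comm_of_orthogonal {x y : Fin 3 → ℝ} (h : x ⬝ᵥ y = 0) :
    pauliVec x * pauliVec y = -(pauliVec y * pauliVec x) := by
  rw [eq_neg_iff_add_eq_zero, pauliVec_mul_add_mul, h]
  simp

theorem trace_pauliVec_mul (x y : Fin 3 → ℝ) :
    (pauliVec x * pauliVec y).trace = ((2 * (x ⬝ᵥ y) : ℝ) : ℂ) := by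
  rw [pauliVec_eq, pauliVec_eq]
  simp [Matrix.trace_fin_two, dotProduct, Fin.sum_univ_three]
  ring_nf
  simp only [Complex.I_sq]
  ring

theorem trace_mul_pauliVec_kronecker (ρ : TwoQubitOp) (x y : Fin 3 → ℝ) :
    (ρ * (pauliVec x ⊗ₖ pauliVec y)).trace.re = x ⬝ᵥ correlationMatrix ρ *ᵥ y := by
  have h : pauliVec x ⊗ₖ pauliVec y =
      ∑ i, ∑ j, ((x i * y j : ℝ) : ℂ) • (pauli i ⊗ₖ pauli j) := by
    ext ⟨p, q⟩ ⟨r, s⟩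
    simp only [pauliVec, Matrix.kroneckerMap_apply, Matrix.sum_apply, Matrix.smul_apply,
      smul_eq_mul, Finset.sum_mul_sum]
    refine Finset.sum_congr rfl fun i _ => Finset.sum_congr rfl fun j _ => ?_
    push_cast
    ring
  rw [h]
  simp only [Finset.mul_sum, Matrix.trace_sum, Matrix.mul_smul, Matrix.trace_smul, Complex.re_sum,
    smul_eq_mul, Complex.re_ofReal_mul, dotProduct, Matrix.mulVec, correlationMatrix,
    Matrix.of_apply]
  refine Finset.sum_congr rfl fun i _ => Finset.sum_congr rfl fun j _ => ?_
  ring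

/-! ### Upper bound in terms of the spectrum -/

section SpectralBounds

variable {W : Matrix (Fin 2 × Fin 2) (Fin 4) ℂ} {a : Fin 4 → ℝ} {ρ : TwoQubitOp}

theorem trace_mul_involution_le (hW : W * Wᴴ = 1)
    (hρ : ρ = W * Matrix.diagonal (fun j => (a j : ℂ)) * Wᴴ) (htr : ρ.trace = 1)
    (ha : Antitone a) (hsum : ∑ j, a j = 1) {P : TwoQubitOp} (hP : P.IsHermitian)
    (hPP : P * P = 1) (hP0 : P.trace = 0) :
    (ρ * P).trace.re ≤ a 0 + a 1 - a 2 - a 3 := by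
  obtain ⟨q, hq0, hq1, hqs, hq⟩ := exists_weights_trace_mul_projection hW
    (P := (1 / 2 : ℝ) • (1 + P))
    (by
      rw [Matrix.IsHermitian, Matrix.conjTranspose_smul, Matrix.conjTranspose_add, hP.eq]
      simp)
    (by
      have h : (1 + P) * (1 + P) = (2 : ℝ) • (1 + P) := by
        rw [add_mul, mul_add, mul_add, hPP, two_smul]
        simp only [one_mul, mul_one]
        abel
      rw [smul_mul_smul_comm, h, smul_smul]
      norm_num) a
  rw [← hρ] at hq
  have h1 : ((1 / 2 : ℝ) • (1 + P)).trace.re = 2 := by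
    simp [Matrix.trace_add, Matrix.trace_smul, hP0]
    norm_num
  have h2 : (ρ * ((1 / 2 : ℝ) • (1 + P))).trace.re = (1 + (ρ * P).trace.re) / 2 := by
    simp [mul_add, Matrix.trace_add, Matrix.trace_smul, htr]
    ring
  rw [h1, Fin.sum_univ_four] at hqs
  rw [h2, Fin.sum_univ_four] at hq
  rw [Fin.sum_univ_four] at hsum
  have h01 : a 1 ≤ a 0 := ha (by decide)
  have h12 : a 2 ≤ a 1 := ha (by decide)
  have h23 : a 3 ≤ a 2 := ha (by decide)
  -- With total weight 2, a₀ + a₁ - ∑ aⱼqⱼ = (a₀ - a₁)(1 - q₀) + (a₁ - a₂)q₂ + (a₁ - a₃)q₃.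
  nlinarith [mul_nonneg (sub_nonneg.2 h01) (sub_nonneg.2 (hq1 0)),
    mul_nonneg (sub_nonneg.2 h12) (hq0 2), mul_nonneg (sub_nonneg.2 h23) (hq0 3),
    mul_nonneg (sub_nonneg.2 h12) (hq0 3)]

/-- The operator (1 + P)(1 + Q)/4 is a projection of trace 1, so its expectation is a convex
combination of the eigenvalues. -/
theorem exists_weights_commuting_involutions (hW : W * Wᴴ = 1)
    (hρ : ρ = W * Matrix.diagonal (fun j => (a j : ℂ)) * Wᴴ) (htr : ρ.trace = 1)
    {P Q : TwoQubitOp} (hP : P.IsHermitian) (hQ : Q.IsHermitian)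
    (hPP : P * P = 1) (hQQ : Q * Q = 1) (hPQ : P * Q = Q * P)
    (hP0 : P.trace = 0) (hQ0 : Q.trace = 0) (hPQ0 : (P * Q).trace = 0) :
    ∃ q : Fin 4 → ℝ, (∀ j, 0 ≤ q j) ∧ ∑ j, q j = 1 ∧
      1 + (ρ * P).trace.re + (ρ * Q).trace.re + (ρ * (P * Q)).trace.re = 4 * ∑ j, a j * q j := by
  obtain ⟨q, hq0, -, hqs, hq⟩ := exists_weights_trace_mul_projection hW
    (P := (1 / 4 : ℝ) • (1 + P + Q + P * Q))
    (by
      rw [Matrix.IsHermitian, Matrix.conjTranspose_smul, Matrix.conjTranspose_add,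
        Matrix.conjTranspose_add, Matrix.conjTranspose_add, Matrix.conjTranspose_mul,
        hP.eq, hQ.eq, hPQ]
      simp)
    (by
      have hP2 : (1 + P) * (1 + P) = (2 : ℝ) • (1 + P) := by
        rw [add_mul, mul_add, mul_add, hPP, two_smul]
        simp only [one_mul, mul_one]
        abel
      have hQ2 : (1 + Q) * (1 + Q) = (2 : ℝ) • (1 + Q) := by
        rw [add_mul, mul_add, mul_add, hQQ, two_smul]
        simp only [one_mul, mul_one]
        abel
      have hc : Commute (1 + Q) (1 + P) :=
        (Commute.one_left _).add_left ((Commute.one_right Q).add_right hPQ.symm)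
      have h : 1 + P + Q + P * Q = (1 + P) * (1 + Q) := by
        rw [add_mul, mul_add, mul_add]
        simp only [one_mul, mul_one]
        abel
      rw [h, smul_mul_smul_comm, hc.mul_mul_mul_comm, hP2, hQ2, smul_mul_smul_comm, smul_smul]
      norm_num) a
  rw [← hρ] at hq
  refine ⟨q, hq0, ?_, ?_⟩
  · rw [hqs]
    simp [Matrix.trace_add, Matrix.trace_smul, hP0, hQ0, hPQ0]
  · rw [← hq]
    simp [mul_add, Matrix.trace_add, Matrix.trace_smul, htr]

/-- The pairs (P, Q) and (-P, -Q) have the same product, so the unwanted expectation of P * Q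
cancels when the lower bound 4a₃ for the second is subtracted from the upper bound 4a₀ for the
first. -/
theorem trace_mul_commuting_involutions_le (hW : W * Wᴴ = 1)
    (hρ : ρ = W * Matrix.diagonal (fun j => (a j : ℂ)) * Wᴴ) (htr : ρ.trace = 1)
    (ha : Antitone a)
    {P Q : TwoQubitOp} (hP : P.IsHermitian) (hQ : Q.IsHermitian)
    (hPP : P * P = 1) (hQQ : Q * Q = 1) (hPQ : P * Q = Q * P)
    (hP0 : P.trace = 0) (hQ0 : Q.trace = 0) (hPQ0 : (P * Q).trace = 0) :
    (ρ * P).trace.re + (ρ * Q).trace.re ≤ 2 * (a 0 - a 3) := by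
  obtain ⟨q, hq0, hqs, hq⟩ :=
    exists_weights_commuting_involutions hW hρ htr hP hQ hPP hQQ hPQ hP0 hQ0 hPQ0
  obtain ⟨r, hr0, hrs, hr⟩ :=
    exists_weights_commuting_involutions hW hρ htr hP.neg hQ.neg (by simpa) (by simpa)
      (by simpa) (by simpa) (by simpa) (by simpa)
  have hup : ∑ j, a j * q j ≤ a 0 := by
    calc ∑ j, a j * q j ≤ ∑ j, a 0 * q j :=
          Finset.sum_le_sum fun j _ => mul_le_mul_of_nonneg_right (ha (Fin.zero_le j)) (hq0 j)
      _ = a 0 := by rw [← Finset.mul_sum, hqs, mul_one]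
  have hlow : a 3 ≤ ∑ j, a j * r j := by
    calc a 3 = ∑ j, a 3 * r j := by rw [← Finset.mul_sum, hrs, mul_one]
      _ ≤ ∑ j, a j * r j :=
          Finset.sum_le_sum fun j _ => mul_le_mul_of_nonneg_right (ha (Fin.le_last j)) (hr0 j)
  simp only [mul_neg, neg_mul, neg_neg, Matrix.trace_neg, Complex.neg_re] at hr
  linarith

theorem dotProduct_correlationMatrix_le (hW : W * Wᴴ = 1)
    (hρ : ρ = W * Matrix.diagonal (fun j => (a j : ℂ)) * Wᴴ) (htr : ρ.trace = 1)
    (ha : Antitone a) (hsum : ∑ j, a j = 1) {x u : Fin 3 → ℝ} (hx : x ⬝ᵥ x = 1)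
    (hu : u ⬝ᵥ u = 1) :
    x ⬝ᵥ correlationMatrix ρ *ᵥ u ≤ a 0 + a 1 - a 2 - a 3 := by
  rw [← trace_mul_pauliVec_kronecker]
  apply trace_mul_involution_le hW hρ htr ha hsum
  · rw [Matrix.IsHermitian, Matrix.conjTranspose_kronecker, (pauliVec_isHermitian x).eq,
      (pauliVec_isHermitian u).eq]
  · rw [← Matrix.mul_kronecker_mul, pauliVec_mul_self hx, pauliVec_mul_self hu,
      Matrix.one_kronecker_one]
  · rw [Matrix.trace_kronecker, trace_pauliVec, zero_mul]

theorem dotProduct_correlationMatrix_add_le (hW : W * Wᴴ = 1)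
    (hρ : ρ = W * Matrix.diagonal (fun j => (a j : ℂ)) * Wᴴ) (htr : ρ.trace = 1)
    (ha : Antitone a) {x u y v : Fin 3 → ℝ} (hx : x ⬝ᵥ x = 1)
    (hu : u ⬝ᵥ u = 1) (hy : y ⬝ᵥ y = 1) (hv : v ⬝ᵥ v = 1) (hxy : x ⬝ᵥ y = 0)
    (huv : u ⬝ᵥ v = 0) :
    x ⬝ᵥ correlationMatrix ρ *ᵥ u + y ⬝ᵥ correlationMatrix ρ *ᵥ v ≤ 2 * (a 0 - a 3) := by
  rw [← trace_mul_pauliVec_kronecker, ← trace_mul_pauliVec_kronecker]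
  apply trace_mul_commuting_involutions_le hW hρ htr ha
  · rw [Matrix.IsHermitian, Matrix.conjTranspose_kronecker, (pauliVec_isHermitian x).eq,
      (pauliVec_isHermitian u).eq]
  · rw [Matrix.IsHermitian, Matrix.conjTranspose_kronecker, (pauliVec_isHermitian y).eq,
      (pauliVec_isHermitian v).eq]
  · rw [← Matrix.mul_kronecker_mul, pauliVec_mul_self hx, pauliVec_mul_self hu,
      Matrix.one_kronecker_one]
  · rw [← Matrix.mul_kronecker_mul, pauliVec_mul_self hy, pauliVec_mul_self hv,
      Matrix.one_kronecker_one]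
  · rw [← Matrix.mul_kronecker_mul, ← Matrix.mul_kronecker_mul,
      pauliVec_mul_comm_of_orthogonal hxy, pauliVec_mul_comm_of_orthogonal huv]
    ext i j
    simp
  · rw [Matrix.trace_kronecker, trace_pauliVec, zero_mul]
  · rw [Matrix.trace_kronecker, trace_pauliVec, zero_mul]
  · rw [← Matrix.mul_kronecker_mul, Matrix.trace_kronecker, trace_pauliVec_mul, hxy]
    simp

/-- If α + β ≤ K, then already α² + β² ≤ K². Otherwise use α² + β² = K² + (α + β - K)² - 2(K - α)(K
- β). -/
theorem add_sq_le_of_le_of_add_le {α β K L : ℝ} (hα : 0 ≤ α) (hβ : 0 ≤ β) (hαK : α ≤ K) (hβK : β ≤ K) (hsum : α + β ≤ K + L) : α ^ 2 + β ^ 2 ≤ K ^ 2 + L ^ 2 := by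
  rcases le_total (α + β) K with h | h
  · nlinarith [mul_nonneg hα hβ, sq_nonneg L]
  · have h1 : 0 ≤ (K - α) * (K - β) := mul_nonneg (sub_nonneg.2 hαK) (sub_nonneg.2 hβK)
    have h2 : (α + β - K) ^ 2 ≤ L ^ 2 := by
      apply pow_le_pow_left₀ <;> linarith
    nlinarith

theorem horodeckiM_le (hW : W * Wᴴ = 1)
    (hρ : ρ = W * Matrix.diagonal (fun j => (a j : ℂ)) * Wᴴ) (htr : ρ.trace = 1)
    (ha : Antitone a) (hsum : ∑ j, a j = 1) :
    horodeckiM ρ ≤ (2 * a 0 + 2 * a 1 - 1) ^ 2 + (2 * a 0 + 2 * a 2 - 1) ^ 2 := by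
  obtain ⟨V, hV1, hV2, hV⟩ := exists_sortedEigenvalues_diagonalization
    (correlationGram_isHermitian ρ) 3 (by simp)
  set l := sortedEigenvalues (correlationGram_isHermitian ρ) 3 (by simp) with hl
  set T := correlationMatrix ρ with hT
  have hdiag : (T * V)ᵀ * (T * V) = Matrix.diagonal l := by
    calc (T * V)ᵀ * (T * V) = Vᴴ * (Tᵀ * T) * V := by
          simp only [Matrix.transpose_mul, Matrix.conjTranspose_eq_transpose_of_trivial,
            Matrix.mul_assoc]
      _ = (Vᴴ * V) * Matrix.diagonal l * (Vᴴ * V) := by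
          rw [hV]
          simp only [Matrix.mul_assoc]
          rfl
      _ = Matrix.diagonal l := by rw [hV1, Matrix.one_mul, Matrix.mul_one]
  have horth : ∀ i j, V.col i ⬝ᵥ V.col j = (1 : Matrix (Fin 3) (Fin 3) ℝ) i j := by
    intro i j
    rw [← hV1]
    simp [Matrix.mul_apply, dotProduct]
  have himg : ∀ i j, (T *ᵥ V.col i) ⬝ᵥ (T *ᵥ V.col j) = Matrix.diagonal l i j := by
    intro i j
    rw [← hdiag]
    rfl
  have hnn : ∀ i, 0 ≤ l i := by
    intro i
    have h := himg i i
    rw [Matrix.diagonal_apply_eq] at h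
    rw [← h]
    exact Finset.sum_nonneg fun k _ => mul_self_nonneg _
  have hunit : ∀ i, V.col i ⬝ᵥ V.col i = 1 := fun i => by rw [horth, Matrix.one_apply_eq]
  have h01 : a 1 ≤ a 0 := ha (by decide)
  have h12 : a 2 ≤ a 1 := ha (by decide)
  have h23 : a 3 ≤ a 2 := ha (by decide)
  have hsum4 := hsum
  rw [Fin.sum_univ_four] at hsum4
  -- The columns of `V` are right singular vectors of `T`; their normalized images are the left
  -- ones, defined only for nonzero singular values.
  have hn : ∀ i, √(l i) ≠ 0 →
      ((√(l i))⁻¹ • (T *ᵥ V.col i)) ⬝ᵥ ((√(l i))⁻¹ • (T *ᵥ V.col i)) = 1 := by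
    intro i hi
    rw [smul_dotProduct, dotProduct_smul, himg, Matrix.diagonal_apply_eq, smul_eq_mul, smul_eq_mul]
    nth_rewrite 3 [← Real.mul_self_sqrt (hnn i)]
    field_simp
  have hval : ∀ i, √(l i) ≠ 0 →
      ((√(l i))⁻¹ • (T *ᵥ V.col i)) ⬝ᵥ T *ᵥ V.col i = √(l i) := by
    intro i hi
    rw [smul_dotProduct, himg, Matrix.diagonal_apply_eq, smul_eq_mul]
    nth_rewrite 2 [← Real.mul_self_sqrt (hnn i)]
    field_simp
  have hK : ∀ i, √(l i) ≤ a 0 + a 1 - a 2 - a 3 := by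
    intro i
    by_cases hi : √(l i) = 0
    · rw [hi]
      linarith
    · rw [← hval i hi]
      exact dotProduct_correlationMatrix_le hW hρ htr ha hsum (hn i hi) (hunit i)
  have hA : √(l 0) + √(l 1) ≤ 2 * (a 0 - a 3) := by
    -- If one singular value vanishes, the bound K on the other suffices, since 2(a₀ - a₃) - K = (a₀
    -- - a₁) + (a₂ - a₃) ≥ 0.
    by_cases h0 : √(l 0) = 0
    · rw [h0]
      linarith [hK 1]
    by_cases h1 : √(l 1) = 0
    · rw [h1]
      linarith [hK 0]
    have h := dotProduct_correlationMatrix_add_le hW hρ htr ha (hn 0 h0) (hunit 0) (hn 1 h1)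
      (hunit 1) (by simp [himg]) (by simp [horth])
    rwa [hval 0 h0, hval 1 h1] at h
  have hfin := add_sq_le_of_le_of_add_le (L := a 0 + a 2 - a 1 - a 3) (Real.sqrt_nonneg (l 0))
    (Real.sqrt_nonneg (l 1)) (hK 0) (hK 1) (by linarith)
  rw [Real.sq_sqrt (hnn 0), Real.sq_sqrt (hnn 1)] at hfin
  have e1 : 2 * a 0 + 2 * a 1 - 1 = a 0 + a 1 - a 2 - a 3 := by linarith
  have e2 : 2 * a 0 + 2 * a 2 - 1 = a 0 + a 2 - a 1 - a 3 := by linarith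
  rw [e1, e2]
  exact hfin

end SpectralBounds

/-! ### Attainment at Bell-diagonal states -/

/-- A diagonal entry is a convex combination of the eigenvalues, hence at least the smallest. This
spares sorting the eigenvalues at Bell-diagonal states, where only a lower bound on M is needed. -/
theorem trace_sub_apply_le_horodeckiM (ρ : TwoQubitOp) (k : Fin 3) :
    ((correlationMatrix ρ)ᵀ * correlationMatrix ρ).trace -
      ((correlationMatrix ρ)ᵀ * correlationMatrix ρ) k k ≤ horodeckiM ρ := by
  obtain ⟨V, hV1, hV2, hV⟩ := exists_sortedEigenvalues_diagonalization
    (correlationGram_isHermitian ρ) 3 (by simp)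
  have hanti := sortedEigenvalues_antitone (correlationGram_isHermitian ρ) 3 (by simp)
  rw [horodeckiM]
  set l := sortedEigenvalues (correlationGram_isHermitian ρ) 3 (by simp) with hl
  set G := (correlationMatrix ρ)ᵀ * correlationMatrix ρ with hG
  have htr : G.trace = l 0 + l 1 + l 2 := by
    rw [hV, Matrix.mul_assoc, Matrix.trace_mul_comm, Matrix.mul_assoc, hV1, Matrix.mul_one,
      Matrix.trace_diagonal, Fin.sum_univ_three]
    rfl
  have hrow : ∑ j, V k j * V k j = 1 := by
    have h := congrFun (congrFun hV2 k) k
    simpa [Matrix.mul_apply] using h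
  have hkk : G k k = ∑ j, l j * (V k j * V k j) := by
    rw [hV, Matrix.mul_apply]
    refine Finset.sum_congr rfl fun j _ => ?_
    simp [Matrix.mul_diagonal]
    ring
  have hmin : l 2 ≤ G k k := by
    calc l 2 = ∑ j, l 2 * (V k j * V k j) := by rw [← Finset.mul_sum, hrow, mul_one]
      _ ≤ ∑ j, l j * (V k j * V k j) :=
          Finset.sum_le_sum fun j _ =>
            mul_le_mul_of_nonneg_right (hanti (Fin.le_last j)) (mul_self_nonneg _)
      _ = G k k := hkk.symm
  linarith

/-- The unitary matrix whose columns are the Bell states. -/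
noncomputable def bellMatrix : Matrix (Fin 2 × Fin 2) (Fin 4) ℂ :=
  Matrix.of fun i k => bellState k i

theorem inv_sqrt_two_mul_self : ((√2 : ℝ) : ℂ)⁻¹ * ((√2 : ℝ) : ℂ)⁻¹ = 1 / 2 := by
  rw [← mul_inv, ← Complex.ofReal_mul, Real.mul_self_sqrt (by norm_num)]
  norm_num

theorem bellMatrix_eq_smul : bellMatrix = ((√2 : ℝ) : ℂ)⁻¹ • Matrix.of fun i k =>
    (![ket 0 0 + ket 1 1, ket 0 0 - ket 1 1, ket 0 1 + ket 1 0, ket 0 1 - ket 1 0] :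
      Fin 4 → Fin 2 × Fin 2 → ℂ) k i := by
  ext i k
  fin_cases k <;> simp [bellMatrix, bellState, mul_add]

theorem bellMatrix_conjTranspose_mul : bellMatrixᴴ * bellMatrix = 1 := by
  rw [bellMatrix_eq_smul, Matrix.conjTranspose_smul, Matrix.smul_mul, Matrix.mul_smul, smul_smul]
  have h : star ((√2 : ℝ) : ℂ)⁻¹ = ((√2 : ℝ) : ℂ)⁻¹ := by simp
  rw [h, inv_sqrt_two_mul_self]
  ext i j
  fin_cases i <;> fin_cases j <;>
    simp [Matrix.mul_apply, Fintype.sum_prod_type, Fin.sum_univ_two, ket, Pi.single_apply] <;>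
    norm_num

theorem bellMatrix_mul_conjTranspose : bellMatrix * bellMatrixᴴ = 1 :=
  (Matrix.mul_eq_one_comm_of_card_eq _ _ _ (by simp)).1 bellMatrix_conjTranspose_mul

theorem bellDiagonal_eq (p : Fin 4 → ℝ) :
    bellDiagonal p = bellMatrix * Matrix.diagonal (fun k => (p k : ℂ)) * bellMatrixᴴ := by
  ext i j
  rw [bellDiagonal, Matrix.sum_apply, Matrix.mul_apply]
  refine Finset.sum_congr rfl fun k _ => ?_
  simp [Matrix.mul_diagonal, Matrix.vecMulVec_apply, bellMatrix]
  ring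

theorem bellDiagonal_eq_matrix (p : Fin 4 → ℝ) :
    bellDiagonal p = (1 / 2 : ℂ) • Matrix.of fun i j : Fin 2 × Fin 2 =>
      if i = j then (if i.1 = i.2 then (p 0 + p 1 : ℂ) else p 2 + p 3)
      else if i.1 ≠ j.1 ∧ i.2 ≠ j.2 then (if i.1 = i.2 then (p 0 - p 1 : ℂ) else p 2 - p 3)
      else 0 := by
  rw [bellDiagonal_eq, bellMatrix_eq_smul, Matrix.conjTranspose_smul]
  simp only [Matrix.smul_mul, Matrix.mul_smul, smul_smul]
  have h : star ((√2 : ℝ) : ℂ)⁻¹ = ((√2 : ℝ) : ℂ)⁻¹ := by simp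
  rw [h, inv_sqrt_two_mul_self]
  congr 1
  ext ⟨i, j⟩ ⟨k, l⟩
  fin_cases i <;> fin_cases j <;> fin_cases k <;> fin_cases l <;>
    simp [Matrix.mul_apply, Fin.sum_univ_four, ket, Pi.single_apply] <;>
    ring

/-- The Bell states are joint eigenvectors of the three operators sᵢ ⊗ sᵢ; the signs are the
eigenvalues. -/
theorem correlationMatrix_bellDiagonal (p : Fin 4 → ℝ) :
    correlationMatrix (bellDiagonal p) =
      Matrix.diagonal ![p 0 - p 1 + p 2 - p 3, -p 0 + p 1 + p 2 - p 3,
        p 0 + p 1 - p 2 - p 3] := by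
  rw [bellDiagonal_eq_matrix]
  ext i j
  fin_cases i <;> fin_cases j <;>
    simp [correlationMatrix, pauli, Matrix.trace, Matrix.mul_apply, Fintype.sum_prod_type,
      Fin.sum_univ_two] <;>
    ring

theorem le_horodeckiM_bellDiagonal {a : Fin 4 → ℝ} (hsum : ∑ j, a j = 1) (π : Equiv.Perm (Fin 4)) :
    (2 * a 0 + 2 * a 1 - 1) ^ 2 + (2 * a 0 + 2 * a 2 - 1) ^ 2 ≤
      horodeckiM (bellDiagonal (fun k => a (π k))) := by
  set p : Fin 4 → ℝ := fun k => a (π k) with hp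
  have hps : ∑ k, p k = 1 := by rw [← hsum]; exact Equiv.sum_comp π a
  have hp2 : ∑ k, p k ^ 2 = ∑ k, a k ^ 2 := Equiv.sum_comp π (fun k => a k ^ 2)
  have h0 : a 0 = p (π.symm 0) := by simp [hp]
  have h3 : a 3 = p (π.symm 3) := by simp [hp]
  have hne : π.symm 0 ≠ π.symm 3 := by simp
  have key := trace_sub_apply_le_horodeckiM (bellDiagonal p)
  rw [correlationMatrix_bellDiagonal, Matrix.diagonal_transpose, Matrix.diagonal_mul_diagonal,
    Matrix.trace_diagonal, Fin.sum_univ_three] at key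
  have k0 := key 0
  have k1 := key 1
  have k2 := key 2
  simp at k0 k1 k2
  rw [Fin.sum_univ_four] at hps hsum
  rw [Fin.sum_univ_four, Fin.sum_univ_four] at hp2
  have hp3 : p 3 = 1 - p 0 - p 1 - p 2 := by linarith
  -- The squared entries of the correlation matrix sum to 4∑pₖ² - 1, so the entry to discard is
  -- ±(2(a₀ + a₃) - 1).
  have hF : (2 * a 0 + 2 * a 1 - 1) ^ 2 + (2 * a 0 + 2 * a 2 - 1) ^ 2 =
      4 * (p 0 ^ 2 + p 1 ^ 2 + p 2 ^ 2 + p 3 ^ 2) - 1 - (2 * (a 0 + a 3) - 1) ^ 2 := by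
    have ha3 : a 3 = 1 - a 0 - a 1 - a 2 := by linarith
    rw [hp2, ha3]
    ring
  rw [hF, h0, h3]
  generalize π.symm 0 = i at hne
  generalize π.symm 3 = j at hne
  rw [hp3] at k0 k1 k2
  -- The entry to discard is set by how the positions of a₀ and a₃ split the four indices into
  -- pairs: {0,2}|{1,3}, {0,3}|{1,2} and {0,1}|{2,3} call for `k0`, `k1` and `k2`.
  fin_cases i <;> fin_cases j <;> first
    | exact absurd rfl hne
    | (simp only [Fin.zero_eta, Fin.mk_one, Fin.reduceFinMk]; rw [hp3]; nlinarith only [k0])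
    | (simp only [Fin.zero_eta, Fin.mk_one, Fin.reduceFinMk]; rw [hp3]; nlinarith only [k1])
    | (simp only [Fin.zero_eta, Fin.mk_one, Fin.reduceFinMk]; rw [hp3]; nlinarith only [k2])

theorem exists_unitaryConj_eq {W V : Matrix (Fin 2 × Fin 2) (Fin 4) ℂ} (hW1 : Wᴴ * W = 1)
    (hV2 : V * Vᴴ = 1) (a : Fin 4 → ℝ) (π : Equiv.Perm (Fin 4)) :
    ∃ U : Matrix.unitaryGroup (Fin 2 × Fin 2) ℂ,
      unitaryConj U (W * Matrix.diagonal (fun k => (a k : ℂ)) * Wᴴ) =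
        V * Matrix.diagonal (fun k => (a (π k) : ℂ)) * Vᴴ := by
  -- Permuting the eigenvector columns absorbs π; then V Xᴴ carries one eigenbasis to the other.
  set X : Matrix (Fin 2 × Fin 2) (Fin 4) ℂ := W.submatrix id π with hX
  have hX1 : Xᴴ * X = 1 := by
    rw [hX, Matrix.conjTranspose_submatrix, ← Matrix.submatrix_mul _ _ π id π Function.bijective_id,
      hW1, Matrix.submatrix_one_equiv]
  have hd : W * Matrix.diagonal (fun k => (a k : ℂ)) * Wᴴ =
      X * Matrix.diagonal (fun k => (a (π k) : ℂ)) * Xᴴ := by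
    have h : Matrix.diagonal (fun k => (a (π k) : ℂ)) =
        (Matrix.diagonal (fun k => (a k : ℂ))).submatrix π π := by
      rw [Matrix.submatrix_diagonal_equiv]
      rfl
    rw [h, hX, Matrix.conjTranspose_submatrix, Matrix.submatrix_mul_equiv,
      Matrix.submatrix_mul_equiv, Matrix.submatrix_id_id]
  refine ⟨⟨V * Xᴴ, ?_⟩, ?_⟩
  · rw [Matrix.mem_unitaryGroup_iff, Matrix.star_eq_conjTranspose, Matrix.conjTranspose_mul,
      Matrix.conjTranspose_conjTranspose]
    calc V * Xᴴ * (X * Vᴴ) = V * (Xᴴ * X) * Vᴴ := by simp only [Matrix.mul_assoc]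
      _ = 1 := by rw [hX1, Matrix.mul_one, hV2]
  · rw [hd]
    simp only [unitaryConj, Matrix.conjTranspose_mul, Matrix.conjTranspose_conjTranspose]
    set D := Matrix.diagonal (fun k => (a (π k) : ℂ))
    calc V * Xᴴ * (X * D * Xᴴ) * (X * Vᴴ) = V * (Xᴴ * X) * D * (Xᴴ * X) * Vᴴ := by
          simp only [Matrix.mul_assoc]
      _ = V * D * Vᴴ := by simp only [hX1, Matrix.mul_one]

theorem theorem1 (σ : TwoQubitOp) (hσ : IsTwoQubitState σ) (a : Fin 4 → ℝ)
    (ha : a = sortedEigenvalues hσ.1.isHermitian 4 (by simp)) :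
    (IsAbsolutelyBellCHSHLocal σ ↔
      (2 * a 0 + 2 * a 1 - 1) ^ 2 + (2 * a 0 + 2 * a 2 - 1) ^ 2 ≤ 1) ∧
    IsGreatest (Set.range fun U : Matrix.unitaryGroup (Fin 2 × Fin 2) ℂ =>
        horodeckiM (unitaryConj U σ))
      ((2 * a 0 + 2 * a 1 - 1) ^ 2 + (2 * a 0 + 2 * a 2 - 1) ^ 2) ∧
    ∀ π : Equiv.Perm (Fin 4),
      (∃ U : Matrix.unitaryGroup (Fin 2 × Fin 2) ℂ,
        unitaryConj U σ = bellDiagonal (fun k => a (π k))) ∧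
      horodeckiM (bellDiagonal (fun k => a (π k))) =
        (2 * a 0 + 2 * a 1 - 1) ^ 2 + (2 * a 0 + 2 * a 2 - 1) ^ 2 := by
  obtain ⟨W, hW1, hW2, hW⟩ := exists_sortedEigenvalues_diagonalization hσ.1.isHermitian 4 (by simp)
  have hanti : Antitone a := ha ▸ sortedEigenvalues_antitone hσ.1.isHermitian 4 (by simp)
  rw [← ha] at hW
  replace hW : σ = W * Matrix.diagonal (fun k => (a k : ℂ)) * Wᴴ := hW
  have hsum : ∑ j, a j = 1 := by
    have h := hσ.2
    rw [hW, Matrix.mul_assoc, Matrix.trace_mul_comm, Matrix.mul_assoc, hW1, Matrix.mul_one,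
      Matrix.trace_diagonal] at h
    exact_mod_cast h
  have hle : ∀ U : Matrix.unitaryGroup (Fin 2 × Fin 2) ℂ, horodeckiM (unitaryConj U σ) ≤
      (2 * a 0 + 2 * a 1 - 1) ^ 2 + (2 * a 0 + 2 * a 2 - 1) ^ 2 := by
    intro U
    have hU1 : (U : TwoQubitOp)ᴴ * U = 1 := Unitary.coe_star_mul_self U
    have hU2 : (U : TwoQubitOp) * (U : TwoQubitOp)ᴴ = 1 := Unitary.coe_mul_star_self U
    refine horodeckiM_le (W := (U : TwoQubitOp) * W) ?_ ?_ ?_ hanti hsum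
    · calc (U : TwoQubitOp) * W * ((U : TwoQubitOp) * W)ᴴ = (U : TwoQubitOp) * (W * Wᴴ) * (U : TwoQubitOp)ᴴ := by
            simp only [Matrix.conjTranspose_mul, Matrix.mul_assoc]
        _ = 1 := by rw [hW2, Matrix.mul_one, hU2]
    · rw [unitaryConj, hW]
      simp only [Matrix.conjTranspose_mul, Matrix.mul_assoc]
    · rw [unitaryConj, Matrix.trace_mul_comm, ← Matrix.mul_assoc, hU1, Matrix.one_mul, hσ.2]
  have hex : ∀ π : Equiv.Perm (Fin 4), ∃ U : Matrix.unitaryGroup (Fin 2 × Fin 2) ℂ,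
      unitaryConj U σ = bellDiagonal (fun k => a (π k)) := by
    intro π
    rw [hW, bellDiagonal_eq]
    exact exists_unitaryConj_eq hW1 bellMatrix_mul_conjTranspose a π
  have heq : ∀ π : Equiv.Perm (Fin 4), horodeckiM (bellDiagonal (fun k => a (π k))) =
      (2 * a 0 + 2 * a 1 - 1) ^ 2 + (2 * a 0 + 2 * a 2 - 1) ^ 2 := by
    intro π
    obtain ⟨U, hU⟩ := hex π
    exact le_antisymm (hU ▸ hle U) (le_horodeckiM_bellDiagonal hsum π)
  -- Any permutation would serve: one attaining unitary gives both the maximum and the necessity of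
  -- the criterion.
  obtain ⟨U₀, hU₀⟩ := hex 1
  have hmax : horodeckiM (unitaryConj U₀ σ) =
      (2 * a 0 + 2 * a 1 - 1) ^ 2 + (2 * a 0 + 2 * a 2 - 1) ^ 2 := by
    rw [hU₀, heq 1]
  refine ⟨⟨fun h => ?_, fun h U => (hle U).trans h⟩, ⟨⟨U₀, hmax⟩, ?_⟩, fun π => ⟨hex π, heq π⟩⟩
  · rw [← hmax]
    exact h U₀
  · rintro _ ⟨U, rfl⟩
    exact hle U
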